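/- Let $R$ be a ring with an ascending $\mathbb Z$-filtration $FR$ ($1\in F_0R$, $F_iR\,F_jR\subseteq F_{i+j}R$, $\bigcup_n F_nR=R$, $\bigcap_n F_nR=0$). Assume that $FR$ is (left) Zariskian, i.e. the Rees ring $\widetilde R=\bigoplus_n F_nR$ is left Noetherian and $F_{-1}R$ lies in the Jacobson radical of $F_0R$, and almost commutative, i.e. the associated graded ring $G(R)=\bigoplus_n F_nR/F_{n-1}R$ is a commutative domain. Let $M\subset\Omega$ be a glider representation: $\Omega$ is a left $R$-module and $M=M_0\supseteq M_1\supseteq\cdots$ are subgroups of $\Omega$ with $F_iR\,M_j\subseteq M_{j-i}$ for $0\le i\le j$. Let $F\Omega$ be an ascending exhaustive filtration of $\Omega$ with $F_iR\,F_j\Omega\subseteq F_{i+j}\Omega$ and $F_{-n}\Omega=M_n$ for $n\ge 0$ (for example $F_n\Omega=\sum_{i-j=n}F_iR\,M_j$ if $FR$ is positive and $\Omega=RM$). Let $R$-tors be the lattice of kernel functors $\kappa$ on left $R$-modules, identified with their Gabriel filters $\mathcal L(\kappa)$ and ordered by inclusion. Put $\mathrm{gen}(\kappa)=\{\tau:\kappa\le\tau\}$,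 so that $\mathrm{gen}(\kappa)\cap\mathrm{gen}(\tau)=\mathrm{gen}(\kappa\vee\tau)$; in the gen-topology, $\mathrm{gen}(\kappa)$ is covered by finitely many $\mathrm{gen}(\kappa_i)$ when $\kappa=\bigwedge_i\kappa_i$. For an $R$-module $N$ let $Q_\kappa(N)=\varinjlim_{I\in\mathcal L(\kappa)}\mathrm{Hom}_R(I,N/\kappa(N))$ be its localization, with canonical map $N\to Q_\kappa(N)$, and let $Q(-,N)$ be the presheaf $\mathrm{gen}(\kappa)\mapsto Q_\kappa(N)$ with the canonical restriction maps. If $N=R$ or $N=\Omega$, put $$F_\gamma Q_\kappa(N)=\{q:\ \exists I\in\mathcal L(\kappa)\ \forall n\in\mathbb Z\ \ (I\cap F_nR)\,q\subseteq \mathrm{im}(F_{n+\gamma}N\to Q_\kappa(N))\}.$$ Put $Q_\kappa(M)=F_0Q_\kappa(\Omega)$, with the chain $F_{-n}Q_\kappa(\Omega)$, $n\ge 0$. We say that $Q(-,\Omega)$ is a sheaf of filtered modules if it satisfies the separation and glueing axioms for all these covers and, moreover, an element obtained by glueing compatible sections $x_i\in F_nQ_{\kappa_i}(\Omega)$ lies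 in $F_nQ_\kappa(\Omega)$, for every $n\in\mathbb Z$. **(1)** If $G(\Omega)$ is a faithful $G(R)$-module and $Q(-,\Omega)$ is a sheaf of filtered modules, then $Q(-,M)$ is a sheaf of glider $F^+Q(-,R)$-representations. **(2)** If $G(\Omega)$ is a torsion-free $G(R)$-module (no nonzero element of $G(R)$ annihilates a nonzero element of $G(\Omega)$), then the same conclusion holds as soon as $Q(-,\Omega)$ satisfies the separation and glueing axioms, with no condition on the degrees of glued sections. Here the conclusion means: with the filtrations above, $Q(-,R)$ is a presheaf of filtered rings (exhaustive and separated) and $Q(-,\Omega)$ a presheaf of (exhaustively) filtered modules over it, with filtered restriction maps; each $Q_\kappa(M)\subset Q_\kappa(\Omega)$ is a glider representation for the positive part of $FQ_\kappa(R)$, i.e. $F_iQ_\kappa(R)\,F_{-j}Q_\kappa(\Omega)\subseteq F_{-(j-i)}Q_\kappa(\Omega)$ for $0\le i\le j$; and $Q(-,M)$ satisfies the separation and glueing axioms, where the glued section lies in $F_{-n}Q_\kappa(\Omega)$ whenever all given sections lie in $F_{-n}Q_{\kappa_i}(\Omega)$, $n\ge 0$. -/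

import Mathlib

open scoped DirectSum

namespace GliderSheaf

universe u v w

/-! ### Filtered rings and modules, Rees objects, associated graded objects -/

/-- An ascending, exhaustive and separated `ℤ`-filtration of a ring, with
`1 ∈ F 0` and `F i * F j ⊆ F (i + j)`. -/
class IsFilteredRing {A : Type u} [Ring A] (F : ℤ → AddSubgroup A) : Prop
    extends SetLike.GradedMonoid F where
  mono : Monotone F
  exhaustive : ∀ a : A, ∃ n, a ∈ F n
  separated : ∀ a : A, (∀ n, a ∈ F n) → a = 0

/-- An ascending, exhaustive `ℤ`-filtration `FM` of an `A`-module, with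
`F i • FM j ⊆ FM (i + j)`. -/
class IsFilteredModule {A : Type u} {M : Type v} [Ring A] [AddCommGroup M] [Module A M]
    (F : ℤ → AddSubgroup A) (FM : ℤ → AddSubgroup M) : Prop
    extends SetLike.GradedSMul F FM where
  mono : Monotone FM
  exhaustive : ∀ x : M, ∃ n, x ∈ FM n

section Graded

variable {R : Type u} [Ring R] (F : ℤ → AddSubgroup R) [IsFilteredRing F]
variable {M : Type v} [AddCommGroup M] [Module R M]
variable (FM : ℤ → AddSubgroup M) [IsFilteredModule F FM]

/-- The Rees ring `⨁ₙ Fₙ R` (the element `r ∈ Fₙ R` in degree `n` is `r Xⁿ`). -/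
abbrev Rees : Type u := ⨁ n : ℤ, F n

/-- The Rees module `⨁ₙ Fₙ M` over the Rees ring. -/
abbrev ReesModule (FM : ℤ → AddSubgroup M) : Type v := ⨁ n : ℤ, FM n

/-- The ideal `⨁ₙ Fₙ₋₁ R` of the Rees ring, i.e. the ideal generated by the central element
`X`, which is `1 ∈ F₁ R` placed in degree `1`. -/
def reesIdeal : Ideal (Rees F) where
  carrier := {f | ∀ n : ℤ, (f n : R) ∈ F (n - 1)}
  zero_mem' := fun n => by simp
  add_mem' := fun {f g} hf hg n => by
    simpa [DirectSum.add_apply] using (F (n - 1)).add_mem (hf n) (hg n)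
  smul_mem' := fun c f hf n => by
    classical
    rw [smul_eq_mul, DirectSum.coe_mul_apply]
    refine AddSubgroup.sum_mem _ fun ij hij => ?_
    have h : ij.1 + (ij.2 - 1) = n - 1 := by
      have := (Finset.mem_filter.1 hij).2
      omega
    rw [← h]
    exact SetLike.mul_mem_graded (c ij.1).2 (hf ij.2)

instance : (reesIdeal F).IsTwoSided where
  mul_mem_of_left := fun {f} c hf n => by
    classical
    rw [DirectSum.coe_mul_apply]
    refine AddSubgroup.sum_mem _ fun ij hij => ?_
    have h : (ij.1 - 1) + ij.2 = n - 1 := by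
      have := (Finset.mem_filter.1 hij).2
      omega
    rw [← h]
    exact SetLike.mul_mem_graded (hf ij.1) (c ij.2).2

/-- The associated graded ring `G(R) = ⨁ₙ Fₙ R / Fₙ₋₁ R`, as the quotient of the Rees ring by
the ideal generated by `X`. -/
abbrev Gr : Type u := Rees F ⧸ reesIdeal F

/-- The associated graded `G(R)`-module `G(M) = ⨁ₙ Fₙ M / Fₙ₋₁ M`, as the quotient `M̃ / X M̃`
of the Rees module. -/
abbrev GrModule : Type v :=
  ReesModule FM ⧸ (reesIdeal F • (⊤ : Submodule (Rees F) (ReesModule FM)))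

/-- A filtration is (left) Zariskian if the Rees ring is left Noetherian and `F₋₁ R` lies in the
Jacobson radical of `F₀ R`. -/
structure IsZariskian : Prop where
  noetherian : IsNoetherianRing (Rees F)
  le_jacobson : ∀ a : SetLike.GradeZero.subring F, (a : R) ∈ F (-1) →
    a ∈ Ring.jacobson (SetLike.GradeZero.subring F)

/-- `FR` is almost commutative: the associated graded ring is a commutative domain. -/
structure IsAlmostCommutative : Prop where
  mul_comm : ∀ a b : Gr F, a * b = b * a
  isDomain : IsDomain (Gr F)

end Graded

/-- A descending chain `M₀ ⊇ M₁ ⊇ ⋯` of subgroups of an `A`-module `Ω` is a glider representation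
(for the positive part of the filtration `F`) if `Fᵢ A · Mⱼ ⊆ Mⱼ₋ᵢ` for `0 ≤ i ≤ j`. -/
structure IsGlider {A : Type u} {Ω : Type v} [Ring A] [AddCommGroup Ω] [Module A Ω]
    (F : ℤ → AddSubgroup A) (M : ℕ → AddSubgroup Ω) : Prop where
  anti : Antitone M
  smul_mem : ∀ i j : ℕ, i ≤ j → ∀ a ∈ F i, ∀ x ∈ M j, a • x ∈ M (j - i)

/-! ### The lattice of torsion theories, as Gabriel filters -/

/-- The left ideal `(I : r) = {a | a r ∈ I}`. -/
def colon {R : Type u} [Ring R] (I : Ideal R) (r : R) : Ideal R :=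
  Submodule.comap (LinearMap.toSpanSingleton R R r) I

theorem mem_colon {R : Type u} [Ring R] {I : Ideal R} {r a : R} :
    a ∈ colon I r ↔ a * r ∈ I := Iff.rfl

/-- `R-tors`: a kernel functor (left exact idempotent radical) on left `R`-modules is given by its
Gabriel filter of left ideals. -/
@[ext]
structure RTors (R : Type u) [Ring R] where
  filter : Set (Ideal R)
  top_mem : ⊤ ∈ filter
  mem_of_le : ∀ {I J : Ideal R}, I ∈ filter → I ≤ J → J ∈ filter
  inf_mem : ∀ {I J : Ideal R}, I ∈ filter → J ∈ filter → I ⊓ J ∈ filter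
  colon_mem : ∀ {I : Ideal R}, I ∈ filter → ∀ r, colon I r ∈ filter
  mem_of_colon : ∀ {I J : Ideal R}, J ∈ filter → (∀ j ∈ J, colon I j ∈ filter) → I ∈ filter

namespace RTors

section Lattice

variable {R : Type u} [Ring R]

/-- `κ ≤ τ` means that the Gabriel filter of `κ` is contained in that of `τ`. -/
instance : PartialOrder (RTors R) where
  le κ τ := κ.filter ⊆ τ.filter
  le_refl κ := Set.Subset.refl _
  le_trans _ _ _ h h' := Set.Subset.trans h h'
  le_antisymm _ _ h h' := RTors.ext (Set.Subset.antisymm h h')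

/-- Infima are intersections of Gabriel filters. -/
instance : InfSet (RTors R) where
  sInf S :=
    { filter := {I | ∀ κ ∈ S, I ∈ κ.filter}
      top_mem := fun κ _ => κ.top_mem
      mem_of_le := fun h hle κ hκ => κ.mem_of_le (h κ hκ) hle
      inf_mem := fun h h' κ hκ => κ.inf_mem (h κ hκ) (h' κ hκ)
      colon_mem := fun h r κ hκ => κ.colon_mem (h κ hκ) r
      mem_of_colon := fun h h' κ hκ => κ.mem_of_colon (h κ hκ) fun a ha => h' a ha κ hκ }

instance : CompleteLattice (RTors R) :=
  completeLatticeOfInf _ fun _ =>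
    ⟨fun _ hκ _ hI => hI _ hκ, fun _ hτ _ hI κ hκ => hτ hκ hI⟩

/-- The basic open set `gen(τ) = {τ' | τ ≤ τ'}`. -/
def gen (τ : RTors R) : Set (RTors R) := Set.Ici τ

theorem gen_subset_gen {κ τ : RTors R} : gen τ ⊆ gen κ ↔ κ ≤ τ := Set.Ici_subset_Ici

theorem gen_inter_gen (κ τ : RTors R) : gen κ ∩ gen τ = gen (κ ⊔ τ) := Set.Ici_inter_Ici

/-- The finite covers of the gen-topology: `gen(κ)` is covered by the `gen(κᵢ)` when
`κ = ⋀ᵢ κᵢ`. -/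
def IsCover (κ : RTors R) {m : ℕ} (κs : Fin m → RTors R) : Prop := κ = ⨅ i, κs i

theorem IsCover.le {κ : RTors R} {m : ℕ} {κs : Fin m → RTors R} (h : IsCover κ κs) (i : Fin m) :
    κ ≤ κs i := by
  rw [h]
  exact iInf_le κs i

end Lattice

/-! ### The localization `Q_κ(M)` -/

section Localization

variable {R : Type u} [Ring R] (κ : RTors R) (M : Type v) [AddCommGroup M] [Module R M]

/-- `κ(M)`, the elements annihilated by some member of the Gabriel filter. -/
def torsion : Submodule R M where
  carrier := {x | ∃ I ∈ κ.filter, ∀ a ∈ I, a • x = 0}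
  zero_mem' := ⟨⊤, κ.top_mem, fun a _ => smul_zero a⟩
  add_mem' := by
    rintro x y ⟨I, hI, hx⟩ ⟨J, hJ, hy⟩
    refine ⟨I ⊓ J, κ.inf_mem hI hJ, fun a ha => ?_⟩
    rw [smul_add, hx a ha.1, hy a ha.2, add_zero]
  smul_mem' := by
    rintro r x ⟨I, hI, hx⟩
    refine ⟨colon I r, κ.colon_mem hI r, fun a ha => ?_⟩
    rw [← mul_smul]
    exact hx _ ha

theorem mem_torsion {x : M} : x ∈ κ.torsion M ↔ ∃ I ∈ κ.filter, ∀ a ∈ I, a • x = 0 := Iff.rfl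

theorem torsion_mono {κ τ : RTors R} (h : κ ≤ τ) : κ.torsion M ≤ τ.torsion M :=
  fun _ ⟨I, hI, hx⟩ => ⟨I, h hI, hx⟩

/-- An `R`-linear map `I → M / κ(M)` with `I` in the Gabriel filter of `κ`. -/
structure PartialHom where
  dom : Ideal R
  mem : dom ∈ κ.filter
  map : dom →ₗ[R] M ⧸ κ.torsion M

/-- Two partial homomorphisms are identified when they agree on a member of the Gabriel filter. -/
instance PartialHom.setoid : Setoid (PartialHom κ M) where
  r p q := ∃ K ∈ κ.filter, ∀ a ∈ K, ∃ (hp : a ∈ p.dom) (hq : a ∈ q.dom), p.map ⟨a, hp⟩ = q.map ⟨a, hq⟩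
  iseqv :=
    { refl := fun p => ⟨p.dom, p.mem, fun _ ha => ⟨ha, ha, rfl⟩⟩
      symm := fun ⟨K, hK, h⟩ => ⟨K, hK, fun a ha => by
        obtain ⟨hp, hq, e⟩ := h a ha
        exact ⟨hq, hp, e.symm⟩⟩
      trans := fun ⟨K, hK, h⟩ ⟨K', hK', h'⟩ => ⟨K ⊓ K', κ.inf_mem hK hK', fun a ha => by
        obtain ⟨hp, _, e⟩ := h a ha.1
        obtain ⟨_, hr, e'⟩ := h' a ha.2
        exact ⟨hp, hr, e.trans e'⟩⟩ }

/-- The localization `Q_κ(M)`, the direct limit of `Hom_R(I, M / κ(M))` over the left ideals `I` in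
the Gabriel filter of `κ`. -/
def Loc : Type (max u v) := Quotient (PartialHom.setoid κ M)

variable {κ M}

namespace PartialHom

/-- The partial homomorphism `a ↦ a x` defined on all of `R`. -/
def const (κ : RTors R) (x : M ⧸ κ.torsion M) : PartialHom κ M where
  dom := ⊤
  mem := κ.top_mem
  map := (LinearMap.toSpanSingleton R _ x).comp (Submodule.subtype _)

/-- Addition on the intersection of the domains. -/
def add (p q : PartialHom κ M) : PartialHom κ M where
  dom := p.dom ⊓ q.dom
  mem := κ.inf_mem p.mem q.mem
  map := p.map.comp (Submodule.inclusion inf_le_left) + q.map.comp (Submodule.inclusion inf_le_right)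

/-- The negative. -/
def neg (p : PartialHom κ M) : PartialHom κ M where
  dom := p.dom
  mem := p.mem
  map := -p.map

/-- The product `r p`, which is `a ↦ p (a r)` on `(I : r)`. -/
def smul (r : R) (p : PartialHom κ M) : PartialHom κ M where
  dom := colon p.dom r
  mem := κ.colon_mem p.mem r
  map := p.map.comp ((LinearMap.toSpanSingleton R R r).restrict fun _ h => h)

/-- Composition with `M / κ(M) → M / τ(M)`, for `κ ≤ τ`. -/
def res {τ : RTors R} (h : κ ≤ τ) (p : PartialHom κ M) : PartialHom τ M where
  dom := p.dom
  mem := h p.mem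
  map := (Submodule.mapQ _ _ LinearMap.id (torsion_mono M h)).comp p.map

end PartialHom

namespace Loc

/-- The class of a partial homomorphism. -/
def mk (p : PartialHom κ M) : Loc κ M := Quotient.mk (PartialHom.setoid κ M) p

theorem mk_eq {p q : PartialHom κ M} (K : Ideal R) (hK : K ∈ κ.filter)
    (h : ∀ a ∈ K, ∃ (hp : a ∈ p.dom) (hq : a ∈ q.dom), p.map ⟨a, hp⟩ = q.map ⟨a, hq⟩) :
    mk p = mk q :=
  Quotient.sound ⟨K, hK, h⟩

instance : Zero (Loc κ M) := ⟨mk (PartialHom.const κ 0)⟩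

instance : Add (Loc κ M) :=
  ⟨Quotient.map₂ PartialHom.add (by
    rintro p p' ⟨K, hK, h⟩ q q' ⟨K', hK', h'⟩
    refine ⟨K ⊓ K', κ.inf_mem hK hK', fun a ha => ?_⟩
    obtain ⟨h1, h2, e⟩ := h a ha.1
    obtain ⟨h3, h4, e'⟩ := h' a ha.2
    exact ⟨⟨h1, h3⟩, ⟨h2, h4⟩, congrArg₂ (· + ·) e e'⟩)⟩

instance : Neg (Loc κ M) :=
  ⟨Quotient.map PartialHom.neg (by
    rintro p p' ⟨K, hK, h⟩
    refine ⟨K, hK, fun a ha => ?_⟩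
    obtain ⟨h1, h2, e⟩ := h a ha
    exact ⟨h1, h2, congrArg (- ·) e⟩)⟩

instance : SMul R (Loc κ M) :=
  ⟨fun r => Quotient.map (PartialHom.smul r) (by
    rintro p p' ⟨K, hK, h⟩
    refine ⟨colon K r, κ.colon_mem hK r, fun a ha => ?_⟩
    obtain ⟨h1, h2, e⟩ := h (a * r) ha
    exact ⟨h1, h2, e⟩)⟩

instance : AddCommGroup (Loc κ M) where
  add_assoc := by
    rintro ⟨p⟩ ⟨q⟩ ⟨r⟩
    exact mk_eq (p.dom ⊓ q.dom ⊓ r.dom) (κ.inf_mem (κ.inf_mem p.mem q.mem) r.mem)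
      fun a ha => ⟨ha, ⟨ha.1.1, ha.1.2, ha.2⟩, add_assoc _ _ _⟩
  zero_add := by
    rintro ⟨p⟩
    exact mk_eq p.dom p.mem fun a ha => ⟨⟨trivial, ha⟩, ha,
      (congrArg (· + p.map ⟨a, ha⟩) (smul_zero a)).trans (zero_add _)⟩
  add_zero := by
    rintro ⟨p⟩
    exact mk_eq p.dom p.mem fun a ha => ⟨⟨ha, trivial⟩, ha,
      (congrArg (p.map ⟨a, ha⟩ + ·) (smul_zero a)).trans (add_zero _)⟩
  nsmul := nsmulRec
  zsmul := zsmulRec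
  neg_add_cancel := by
    rintro ⟨p⟩
    exact mk_eq p.dom p.mem fun a ha => ⟨⟨ha, ha⟩, trivial,
      (neg_add_cancel (p.map ⟨a, ha⟩)).trans (smul_zero a).symm⟩
  add_comm := by
    rintro ⟨p⟩ ⟨q⟩
    exact mk_eq (p.dom ⊓ q.dom) (κ.inf_mem p.mem q.mem)
      fun a ha => ⟨ha, ⟨ha.2, ha.1⟩, add_comm _ _⟩

instance : Module R (Loc κ M) where
  one_smul := by
    rintro ⟨p⟩
    refine mk_eq p.dom p.mem fun a ha => ⟨show a * 1 ∈ p.dom by rwa [mul_one], ha, ?_⟩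
    exact congrArg p.map (Subtype.ext (mul_one a))
  mul_smul := by
    rintro r s ⟨p⟩
    refine mk_eq (colon p.dom (r * s)) (κ.colon_mem p.mem _) fun a ha =>
      ⟨ha, show a * r * s ∈ p.dom by rw [mul_assoc]; exact ha, ?_⟩
    exact congrArg p.map (Subtype.ext (mul_assoc a r s).symm)
  smul_zero := by
    rintro r
    exact mk_eq ⊤ κ.top_mem fun a _ => ⟨trivial, trivial,
      (smul_zero (a * r)).trans (smul_zero a).symm⟩
  smul_add := by
    rintro r ⟨p⟩ ⟨q⟩
    exact mk_eq (colon p.dom r ⊓ colon q.dom r)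
      (κ.inf_mem (κ.colon_mem p.mem r) (κ.colon_mem q.mem r)) fun a ha => ⟨ha, ha, rfl⟩
  add_smul := by
    rintro r s ⟨p⟩
    refine mk_eq (colon p.dom r ⊓ colon p.dom s)
      (κ.inf_mem (κ.colon_mem p.mem r) (κ.colon_mem p.mem s)) fun a ha =>
      ⟨show a * (r + s) ∈ p.dom by rw [mul_add]; exact p.dom.add_mem ha.1 ha.2, ha, ?_⟩
    refine Eq.trans ?_ (p.map.map_add ⟨a * r, ha.1⟩ ⟨a * s, ha.2⟩)
    exact congrArg p.map (Subtype.ext (mul_add a r s))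
  zero_smul := by
    rintro ⟨p⟩
    refine mk_eq ⊤ κ.top_mem fun a _ =>
      ⟨show a * 0 ∈ p.dom by rw [mul_zero]; exact p.dom.zero_mem, trivial, ?_⟩
    refine Eq.trans ?_ (p.map.map_zero.trans (smul_zero a).symm)
    exact congrArg p.map (Subtype.ext (mul_zero a))

/-- The canonical map `M / κ(M) → Q_κ(M)`. -/
def ofQuot (κ : RTors R) (M : Type v) [AddCommGroup M] [Module R M] :
    (M ⧸ κ.torsion M) →ₗ[R] Loc κ M where
  toFun x := mk (PartialHom.const κ x)
  map_add' x y := mk_eq ⊤ κ.top_mem fun a _ => ⟨trivial, ⟨trivial, trivial⟩, smul_add a x y⟩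
  map_smul' r x := mk_eq ⊤ κ.top_mem fun a _ => ⟨trivial, trivial, (mul_smul a r x).symm⟩

/-- The localization morphism `j_κ : M → Q_κ(M)`. -/
def j (κ : RTors R) (M : Type v) [AddCommGroup M] [Module R M] : M →ₗ[R] Loc κ M :=
  (ofQuot κ M).comp (Submodule.mkQ _)

/-- The restriction morphism `Q_κ(M) → Q_τ(M)` for `κ ≤ τ`. -/
def res {τ : RTors R} (h : κ ≤ τ) (M : Type v) [AddCommGroup M] [Module R M] :
    Loc κ M →ₗ[R] Loc τ M where
  toFun := Quotient.map (PartialHom.res h) (by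
    rintro p p' ⟨K, hK, e⟩
    refine ⟨K, h hK, fun a ha => ?_⟩
    obtain ⟨h1, h2, e'⟩ := e a ha
    exact ⟨h1, h2, congrArg _ e'⟩)
  map_add' := by
    rintro ⟨p⟩ ⟨q⟩
    exact mk_eq (p.dom ⊓ q.dom) (h (κ.inf_mem p.mem q.mem))
      fun a ha => ⟨ha, ha, map_add (Submodule.mapQ _ _ LinearMap.id (torsion_mono M h))
        (p.map ⟨a, ha.1⟩) (q.map ⟨a, ha.2⟩)⟩
  map_smul' := by
    rintro r ⟨p⟩
    exact mk_eq (colon p.dom r) (h (κ.colon_mem p.mem r)) fun a ha => ⟨ha, ha, rfl⟩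

/-! #### `Q_κ(M)` is torsion free and `κ`-injective, with `Q_κ(M) / j(M)` torsion -/

theorem quot_eq_zero {x : M ⧸ κ.torsion M} {I : Ideal R} (hI : I ∈ κ.filter)
    (h : ∀ a ∈ I, a • x = 0) : x = 0 := by
  obtain ⟨m, rfl⟩ := Submodule.mkQ_surjective _ x
  refine (Submodule.Quotient.mk_eq_zero _).2 ?_
  have key : ∀ a ∈ I, a • m ∈ κ.torsion M := fun a ha =>
    (Submodule.Quotient.mk_eq_zero _).1 (h a ha)
  let J : Ideal R := Submodule.comap (LinearMap.toSpanSingleton R M m) ⊥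
  have hJ : ∀ a, a ∈ J ↔ a • m = 0 := fun a => by simp [J]
  refine ⟨J, κ.mem_of_colon hI fun a ha => ?_, fun a ha => (hJ a).1 ha⟩
  obtain ⟨K, hK, hKm⟩ := key a ha
  refine κ.mem_of_le hK fun c hc => (hJ _).2 ?_
  exact (mul_smul c a m).trans (hKm c hc)

theorem smul_mk (p : PartialHom κ M) (a : R) (ha : a ∈ p.dom) :
    a • mk p = ofQuot κ M (p.map ⟨a, ha⟩) := by
  refine mk_eq ⊤ κ.top_mem fun b _ => ⟨p.dom.mul_mem_left b ha, trivial, ?_⟩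
  exact p.map.map_smul b ⟨a, ha⟩

theorem ofQuot_injective (κ : RTors R) (M : Type v) [AddCommGroup M] [Module R M] :
    Function.Injective (ofQuot κ M) := by
  refine (injective_iff_map_eq_zero _).2 fun x hx => ?_
  obtain ⟨K, hK, h⟩ := Quotient.exact hx
  refine quot_eq_zero hK fun a ha => ?_
  obtain ⟨_, _, e⟩ := h a ha
  exact e.trans (smul_zero a)

theorem exists_ofQuot (x : Loc κ M) :
    ∃ I ∈ κ.filter, ∀ a ∈ I, ∃ y, a • x = ofQuot κ M y := by
  obtain ⟨p⟩ := x
  exact ⟨p.dom, p.mem, fun a ha => ⟨_, smul_mk p a ha⟩⟩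

theorem exists_j (x : Loc κ M) : ∃ I ∈ κ.filter, ∀ a ∈ I, ∃ m, a • x = j κ M m := by
  obtain ⟨I, hI, h⟩ := exists_ofQuot x
  refine ⟨I, hI, fun a ha => ?_⟩
  obtain ⟨y, hy⟩ := h a ha
  obtain ⟨m, rfl⟩ := Submodule.mkQ_surjective _ y
  exact ⟨m, hy⟩

theorem j_eq_zero_iff {m : M} : j κ M m = 0 ↔ m ∈ κ.torsion M := by
  rw [← Submodule.Quotient.mk_eq_zero (κ.torsion M)]
  exact map_eq_zero_iff (ofQuot κ M) (ofQuot_injective κ M)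

theorem eq_zero {x : Loc κ M} {I : Ideal R} (hI : I ∈ κ.filter) (h : ∀ a ∈ I, a • x = 0) :
    x = 0 := by
  obtain ⟨p⟩ := x
  refine mk_eq (I ⊓ p.dom) (κ.inf_mem hI p.mem) fun a ha => ⟨ha.2, trivial, ?_⟩
  refine (ofQuot_injective κ M ?_).trans (smul_zero a).symm
  rw [← smul_mk p a ha.2, map_zero]
  exact h a ha.1

theorem eq_of_smul_eq {x y : Loc κ M} {I : Ideal R} (hI : I ∈ κ.filter)
    (h : ∀ a ∈ I, a • x = a • y) : x = y :=
  sub_eq_zero.1 (eq_zero hI fun a ha => by rw [smul_sub, h a ha, sub_self])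

theorem exists_extension {I : Ideal R} (hI : I ∈ κ.filter) (f : I →ₗ[R] Loc κ M) :
    ∃ x : Loc κ M, ∀ a : I, (a : R) • x = f a := by
  let J : Submodule R I := Submodule.comap f (LinearMap.range (ofQuot κ M))
  let e := LinearEquiv.ofInjective (ofQuot κ M) (ofQuot_injective κ M)
  have hmem : ∀ a (ha : a ∈ J.map I.subtype), ∃ hI' : a ∈ I, f ⟨a, hI'⟩ ∈ LinearMap.range (ofQuot κ M) := by
    rintro a ⟨b, hb, rfl⟩
    exact ⟨b.2, hb⟩
  let g : (J.map I.subtype : Ideal R) →ₗ[R] M ⧸ κ.torsion M :=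
    e.symm.toLinearMap.comp
      ((f.comp (Submodule.inclusion fun a ha => (hmem a ha).1)).codRestrict _
        fun a => (hmem a a.2).2)
  have hg : ∀ a, ofQuot κ M (g a) = f ⟨a, (hmem a a.2).1⟩ := fun a =>
    congrArg Subtype.val (e.apply_symm_apply ⟨f ⟨a, (hmem a a.2).1⟩, (hmem a a.2).2⟩)
  have hcolon : ∀ a (ha : a ∈ I), colon (J.map I.subtype) a ∈ κ.filter := by
    intro a ha
    obtain ⟨K, hK, h⟩ := exists_ofQuot (f ⟨a, ha⟩)
    refine κ.mem_of_le hK fun c hc => ?_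
    obtain ⟨y, hy⟩ := h c hc
    exact ⟨⟨c * a, I.mul_mem_left c ha⟩, ⟨y, hy.symm.trans (f.map_smul c ⟨a, ha⟩).symm⟩, rfl⟩
  let p : PartialHom κ M := ⟨J.map I.subtype, κ.mem_of_colon hI hcolon, g⟩
  have hp : ∀ a (ha : a ∈ p.dom), a • mk p = f ⟨a, (hmem a ha).1⟩ :=
    fun a ha => (smul_mk p a ha).trans (hg ⟨a, ha⟩)
  refine ⟨mk p, fun a => eq_of_smul_eq (hcolon a a.2) fun c hc => ?_⟩
  rw [← mul_smul, hp (c * a) hc, ← f.map_smul]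
  rfl

/-! #### The ring structure of `Q_κ(R)` and its action on `Q_κ(M)` -/

theorem smul_eq_of_j_eq {b b' : R} (h : j κ R b = j κ R b') (x : Loc κ M) : b • x = b' • x := by
  have h0 : j κ R (b - b') = 0 := by rw [map_sub, h, sub_self]
  obtain ⟨I, hI, hb⟩ := j_eq_zero_iff.1 h0
  refine eq_of_smul_eq hI fun a ha => ?_
  have := hb a ha
  rw [smul_eq_mul, mul_sub, sub_eq_zero] at this
  rw [← mul_smul, this, mul_smul]

theorem exists_smul (q : Loc κ R) (x : Loc κ M) :
    ∃ y : Loc κ M, ∀ a b : R, a • q = j κ R b → a • y = b • x := by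
  let I : Ideal R := Submodule.comap (LinearMap.toSpanSingleton R _ q) (LinearMap.range (j κ R))
  have hI : I ∈ κ.filter := by
    obtain ⟨K, hK, h⟩ := exists_j q
    refine κ.mem_of_le hK fun a ha => ?_
    obtain ⟨m, hm⟩ := h a ha
    exact ⟨m, hm.symm⟩
  choose b hb using fun a : I => a.2
  have hb' : ∀ a : I, j κ R (b a) = (a : R) • q := hb
  obtain ⟨y, hy⟩ := exists_extension hI
    { toFun := fun a => b a • x
      map_add' := fun a a' => by
        rw [← add_smul]
        refine smul_eq_of_j_eq ?_ x
        rw [map_add, hb', hb', hb', Submodule.coe_add, add_smul]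
      map_smul' := fun r a => by
        rw [RingHom.id_apply, ← mul_smul]
        refine smul_eq_of_j_eq ?_ x
        rw [← smul_eq_mul, map_smul, hb', hb', Submodule.coe_smul, smul_eq_mul, mul_smul] }
  refine ⟨y, fun a c hac => ?_⟩
  have ha : a ∈ I := ⟨c, hac.symm⟩
  refine (hy ⟨a, ha⟩).trans (smul_eq_of_j_eq ?_ x)
  rw [hb', ← hac]

/-- The product `q x` of `q ∈ Q_κ(R)` and `x ∈ Q_κ(M)`: the unique element of `Q_κ(M)` with
`a (q x) = b x` whenever `a q = j(b)`. -/
noncomputable def act (q : Loc κ R) (x : Loc κ M) : Loc κ M := (exists_smul q x).choose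

theorem smul_act {q : Loc κ R} {a b : R} (h : a • q = j κ R b) (x : Loc κ M) :
    a • act q x = b • x := (exists_smul q x).choose_spec a b h

theorem act_unique {q : Loc κ R} {x y : Loc κ M}
    (h : ∀ a b : R, a • q = j κ R b → a • y = b • x) : y = act q x := by
  obtain ⟨I, hI, hq⟩ := exists_j q
  refine eq_of_smul_eq hI fun a ha => ?_
  obtain ⟨b, hb⟩ := hq a ha
  rw [h a b hb, smul_act hb]

theorem act_j (r : R) (x : Loc κ M) : act (j κ R r) x = r • x :=
  (act_unique fun a b h => by
    rw [← mul_smul]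
    refine smul_eq_of_j_eq ?_ x
    rw [← h, ← smul_eq_mul, map_smul]).symm

theorem act_one (x : Loc κ M) : act (j κ R 1) x = x := by rw [act_j, one_smul]

theorem act_add (q : Loc κ R) (x y : Loc κ M) : act q (x + y) = act q x + act q y :=
  (act_unique fun a b h => by rw [smul_add, smul_add, smul_act h, smul_act h]).symm

theorem act_zero (q : Loc κ R) : act q (0 : Loc κ M) = 0 :=
  (act_unique fun a b _ => by rw [smul_zero, smul_zero]).symm

theorem add_act (p q : Loc κ R) (x : Loc κ M) : act (p + q) x = act p x + act q x := by
  obtain ⟨I, hI, hp⟩ := exists_j p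
  obtain ⟨J, hJ, hq⟩ := exists_j q
  refine eq_of_smul_eq (κ.inf_mem hI hJ) fun a ha => ?_
  obtain ⟨b, hb⟩ := hp a ha.1
  obtain ⟨c, hc⟩ := hq a ha.2
  rw [smul_add, smul_act hb, smul_act hc, ← add_smul]
  exact smul_act (by rw [smul_add, hb, hc, map_add]) x

theorem zero_act (x : Loc κ M) : act (0 : Loc κ R) x = 0 := by
  rw [← map_zero (j κ R), act_j, zero_smul]

theorem smul_act_assoc (r : R) (q : Loc κ R) (x : Loc κ M) : act (r • q) x = r • act q x :=
  (act_unique fun a b h => by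
    rw [← mul_smul]
    exact smul_act (by rw [mul_smul, h]) x).symm

theorem act_act (p q : Loc κ R) (x : Loc κ M) : act (act p q) x = act p (act q x) :=
  act_unique fun a b h => by rw [← smul_act_assoc, smul_act h, smul_act_assoc]

noncomputable instance : Ring (Loc κ R) where
  mul := act
  one := j κ R 1
  zero_mul := zero_act
  mul_zero := act_zero
  left_distrib := act_add
  right_distrib := add_act
  mul_assoc := act_act
  one_mul := act_one
  mul_one q := by
    refine (act_unique fun a b h => ?_).symm
    rw [h]
    refine Eq.trans ?_ ((j κ R).map_smul b 1)
    rw [smul_eq_mul, mul_one]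
  zsmul := zsmulRec
  neg_add_cancel := neg_add_cancel

noncomputable instance : Module (Loc κ R) (Loc κ M) where
  smul := act
  one_smul := act_one
  mul_smul := act_act
  smul_zero := act_zero
  smul_add := act_add
  add_smul := add_act
  zero_smul := zero_act

end Loc

/-- The quotient filtration: `q ∈ F_γ Q_κ(M)` when there is `I` in the Gabriel filter of `κ` with
`F_n I · q ⊆ F_{n+γ} (M / κ(M))` for all `n`, where `F_n I = I ∩ F_n R`. -/
def locFilt (κ : RTors R) (F : ℤ → AddSubgroup R) (FM : ℤ → AddSubgroup M) (γ : ℤ) :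
    AddSubgroup (Loc κ M) where
  carrier := {q | ∃ I ∈ κ.filter, ∀ n : ℤ, ∀ a ∈ I, a ∈ F n → ∃ m ∈ FM (n + γ), a • q = Loc.j κ M m}
  zero_mem' := ⟨⊤, κ.top_mem, fun n a _ _ =>
    ⟨0, (FM (n + γ)).zero_mem, by rw [smul_zero, map_zero]⟩⟩
  add_mem' := by
    rintro p q ⟨I, hI, hp⟩ ⟨J, hJ, hq⟩
    refine ⟨I ⊓ J, κ.inf_mem hI hJ, fun n a ha haF => ?_⟩
    obtain ⟨m, hm, e⟩ := hp n a ha.1 haF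
    obtain ⟨m', hm', e'⟩ := hq n a ha.2 haF
    exact ⟨m + m', (FM (n + γ)).add_mem hm hm', by rw [smul_add, e, e', map_add]⟩
  neg_mem' := by
    rintro p ⟨I, hI, hp⟩
    refine ⟨I, hI, fun n a ha haF => ?_⟩
    obtain ⟨m, hm, e⟩ := hp n a ha haF
    exact ⟨-m, (FM (n + γ)).neg_mem hm, by rw [smul_neg, e, map_neg]⟩

end Localization

end RTors

/-! ### Presheaves and sheaves on `R-tors`

The presheaf `Q(-, N)` has sections `Q_κ(N)` over `gen(κ)` and the restriction maps `Loc.res`. -/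

open RTors

section Sheaves

variable {R : Type u} [Ring R] (F : ℤ → AddSubgroup R)
variable {Ω : Type v} [AddCommGroup Ω] [Module R Ω] (FΩ : ℤ → AddSubgroup Ω)

/-- `Q(-, R)` with the quotient filtrations is a presheaf of filtered rings. -/
structure IsPresheafOfFilteredRings : Prop where
  filtered : ∀ κ : RTors R, IsFilteredRing (locFilt κ F F)
  res_self : ∀ (κ : RTors R) (q : Loc κ R), Loc.res le_rfl R q = q
  res_res : ∀ {κ τ σ : RTors R} (h : κ ≤ τ) (h' : τ ≤ σ) (q : Loc κ R),
    Loc.res h' R (Loc.res h R q) = Loc.res (h.trans h') R q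
  res_one : ∀ {κ τ : RTors R} (h : κ ≤ τ), Loc.res h R (1 : Loc κ R) = 1
  res_mul : ∀ {κ τ : RTors R} (h : κ ≤ τ) (p q : Loc κ R),
    Loc.res h R (p * q) = Loc.res h R p * Loc.res h R q
  res_mem : ∀ {κ τ : RTors R} (h : κ ≤ τ) (n : ℤ), ∀ q ∈ locFilt κ F F n,
    Loc.res h R q ∈ locFilt τ F F n

/-- `Q(-, Ω)` with the quotient filtrations is a presheaf of filtered modules over the presheaf of
filtered rings `Q(-, R)`. -/
structure IsPresheafOfFilteredModules : Prop where
  filtered : ∀ κ : RTors R, IsFilteredModule (locFilt κ F F) (locFilt κ F FΩ)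
  res_self : ∀ (κ : RTors R) (x : Loc κ Ω), Loc.res le_rfl Ω x = x
  res_res : ∀ {κ τ σ : RTors R} (h : κ ≤ τ) (h' : τ ≤ σ) (x : Loc κ Ω),
    Loc.res h' Ω (Loc.res h Ω x) = Loc.res (h.trans h') Ω x
  res_smul : ∀ {κ τ : RTors R} (h : κ ≤ τ) (q : Loc κ R) (x : Loc κ Ω),
    Loc.res h Ω (q • x) = Loc.res h R q • Loc.res h Ω x
  res_mem : ∀ {κ τ : RTors R} (h : κ ≤ τ) (n : ℤ), ∀ x ∈ locFilt κ F FΩ n,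
    Loc.res h Ω x ∈ locFilt τ F FΩ n

/-- Sections `xᵢ ∈ Q_{κᵢ}(Ω)` which agree on the intersections
`gen(κᵢ) ∩ gen(κⱼ) = gen(κᵢ ∨ κⱼ)`. -/
def Compatible {m : ℕ} {κs : Fin m → RTors R} (x : ∀ i, Loc (κs i) Ω) : Prop :=
  ∀ i k, Loc.res (le_sup_left : κs i ≤ κs i ⊔ κs k) Ω (x i) =
    Loc.res (le_sup_right : κs k ≤ κs i ⊔ κs k) Ω (x k)

/-- The presheaf `Q(-, Ω)`, without filtrations, satisfies the separation and glueing axioms. -/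
structure IsSheafOfModules (R : Type u) [Ring R] (Ω : Type v) [AddCommGroup Ω] [Module R Ω] :
    Prop where
  sep : ∀ {κ : RTors R} {m : ℕ} {κs : Fin m → RTors R} (h : IsCover κ κs) (x : Loc κ Ω),
    (∀ i, Loc.res (h.le i) Ω x = 0) → x = 0
  glue : ∀ {κ : RTors R} {m : ℕ} {κs : Fin m → RTors R} (h : IsCover κ κs)
    (x : ∀ i, Loc (κs i) Ω), Compatible x → ∃ y : Loc κ Ω, ∀ i, Loc.res (h.le i) Ω y = x i

/-- The sheaf axioms for the presheaf `Q(-, Ω)` of filtered modules: it is a sheaf of modules, and a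
glued section has degree at most the highest degree of the given sections. -/
structure FilteredSheafAxioms : Prop extends IsSheafOfModules R Ω where
  glue_mem : ∀ {κ : RTors R} {m : ℕ} {κs : Fin m → RTors R} (h : IsCover κ κs)
    (x : ∀ i, Loc (κs i) Ω), Compatible x → ∀ n : ℤ, (∀ i, x i ∈ locFilt (κs i) F FΩ n) →
    ∀ y : Loc κ Ω, (∀ i, Loc.res (h.le i) Ω y = x i) → y ∈ locFilt κ F FΩ n

/-- The degree zero part `κ ↦ F₀ Q_κ(Ω)` of `Q(-, Ω)`, with the chains `F₋ₙ Q_κ(Ω)`, `n ≥ 0`, is a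
sheaf of glider representations over the positive part of the presheaf of filtered rings
`Q(-, R)`. -/
structure IsSheafOfGliders : Prop where
  rings : IsPresheafOfFilteredRings F
  modules : IsPresheafOfFilteredModules F FΩ
  glider : ∀ κ : RTors R, IsGlider (locFilt κ F F) fun n : ℕ => locFilt κ F FΩ (-(n : ℤ))
  sep : ∀ {κ : RTors R} {m : ℕ} {κs : Fin m → RTors R} (h : IsCover κ κs),
    ∀ x ∈ locFilt κ F FΩ 0, (∀ i, Loc.res (h.le i) Ω x = 0) → x = 0
  glue : ∀ {κ : RTors R} {m : ℕ} {κs : Fin m → RTors R} (h : IsCover κ κs)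
    (x : ∀ i, Loc (κs i) Ω), (∀ i, x i ∈ locFilt (κs i) F FΩ 0) → Compatible x →
    ∃ y ∈ locFilt κ F FΩ 0, (∀ i, Loc.res (h.le i) Ω y = x i) ∧
      ∀ n : ℕ, (∀ i, x i ∈ locFilt (κs i) F FΩ (-(n : ℤ))) → y ∈ locFilt κ F FΩ (-(n : ℤ))

end Sheaves

end GliderSheaf

namespace GliderSheaf

universe u v

open RTors

/-! ### Degrees and principal symbols -/

/-! An element of `Q_κ(N)` is known through its multiples by a member of `κ.filter`, which lie in
the image of `N`; so everything reduces to degrees in `R` and `N`. Since `G(R)` is a domain, degrees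
in `R` are additive (`mul_notMem`) and `R` is a domain. Either `⊥ ∈ κ.filter` and `Q_κ = 0`, or each
member of the filter has a nonzero element and `R` embeds in `Q_κ(R)`. In the second case the
embedding makes the quotient filtrations multiplicative (`act_mem_locFilt`), and additivity of
degrees makes that of `Q_κ(R)` separated (`eq_zero_of_forall_mem_locFilt`). Exhaustiveness is an
ascending chain argument in the Noetherian Rees ring (`exists_mem_locFilt`). The glider condition is
a case of multiplicativity, so (1) follows from glueing in degrees `-n`. For (2), torsion-freeness
of `G(Ω)` makes multiplication by an element of degree `d` shift degrees by exactly `d`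
(`mem_of_smul_mem`). Hence the degree of a section can be read off after restriction to any one
nontrivial `κᵢ` (`mem_locFilt_of_res_mem`), and glueing respects degrees automatically. -/

theorem exists_degree {M : Type v} [AddCommGroup M] {FM : ℤ → AddSubgroup M} (mono : Monotone FM)
    {x : M} {k n : ℤ} (hn : x ∈ FM n) (hk : x ∉ FM k) :
    ∃ d, k < d ∧ x ∈ FM d ∧ x ∉ FM (d - 1) := by
  have lt_of_mem : ∀ z, x ∈ FM z → k < z := fun z hz =>
    not_le.1 fun h => hk (mono h hz)
  obtain ⟨d, hd, hmin⟩ := Int.exists_least_of_bdd (P := fun z => x ∈ FM z)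
    ⟨k, fun z hz => (lt_of_mem z hz).le⟩ ⟨n, hn⟩
  exact ⟨d, lt_of_mem d hd, hd, fun h => by have := hmin _ h; omega⟩

section Degree

variable {R : Type u} [Ring R] {F : ℤ → AddSubgroup R} [IsFilteredRing F]
variable {M : Type v} [AddCommGroup M] [Module R M]
variable {FM : ℤ → AddSubgroup M} [IsFilteredModule F FM]

theorem exists_ring_degree {r : R} (hr : r ≠ 0) : ∃ d, r ∈ F d ∧ r ∉ F (d - 1) := by
  obtain ⟨n, hn⟩ := IsFilteredRing.exhaustive (F := F) r
  obtain ⟨k, hk⟩ : ∃ k, r ∉ F k := by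
    by_contra! h
    exact hr (IsFilteredRing.separated r h)
  obtain ⟨d, -, h⟩ := exists_degree IsFilteredRing.mono hn hk
  exact ⟨d, h⟩

variable (F) in
theorem of_mem_reesIdeal {n : ℤ} (r : F n) :
    DirectSum.of (fun n => F n) n r ∈ reesIdeal F ↔ (r : R) ∈ F (n - 1) := by
  constructor
  · intro h
    have := h n
    rwa [DirectSum.of_eq_same] at this
  · intro h k
    by_cases hk : n = k
    · subst hk
      rwa [DirectSum.of_eq_same]
    · rw [DirectSum.of_eq_of_ne _ _ _ (Ne.symm hk)]
      exact zero_mem _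

/-- The principal symbols of `r` and `s` are nonzero in `G(R)`, so their product, the class of `r *
s` in degree `d + e`, is nonzero as well. -/
theorem mul_notMem [IsDomain (Gr F)] {r s : R} {d e : ℤ} (hr : r ∈ F d) (hr' : r ∉ F (d - 1))
    (hs : s ∈ F e) (hs' : s ∉ F (e - 1)) : r * s ∉ F (d + e - 1) := by
  intro h
  have key : Ideal.Quotient.mk (reesIdeal F) (DirectSum.of (fun n => F n) d ⟨r, hr⟩) *
      Ideal.Quotient.mk (reesIdeal F) (DirectSum.of (fun n => F n) e ⟨s, hs⟩) = 0 := by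
    rw [← map_mul, DirectSum.of_mul_of, Ideal.Quotient.eq_zero_iff_mem]
    exact (of_mem_reesIdeal F _).2 h
  rcases mul_eq_zero.1 key with h | h
  · exact hr' ((of_mem_reesIdeal F _).1 (Ideal.Quotient.eq_zero_iff_mem.1 h))
  · exact hs' ((of_mem_reesIdeal F _).1 (Ideal.Quotient.eq_zero_iff_mem.1 h))

variable (F) in
theorem noZeroDivisors_of_isDomain_gr [IsDomain (Gr F)] : NoZeroDivisors R where
  eq_zero_or_eq_zero_of_mul_eq_zero := by
    intro r s h
    by_contra! hrs
    obtain ⟨d, hd, hd'⟩ := exists_ring_degree (F := F) hrs.1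
    obtain ⟨e, he, he'⟩ := exists_ring_degree (F := F) hrs.2
    exact mul_notMem hd hd' he he' (h ▸ zero_mem _)

-- Detects when a principal symbol vanishes in `G(M)`. Coefficients from `reesIdeal F` lower every
-- component of a product by one degree; conversely an element of lower degree is `X` times itself.
variable (F) in
theorem of_mem_reesIdeal_smul_top {n : ℤ} (x : FM n) :
    DirectSum.of (fun n => FM n) n x ∈
      (reesIdeal F • (⊤ : Submodule (Rees F) (ReesModule FM))) ↔ (x : M) ∈ FM (n - 1) := by
  constructor
  · intro h
    suffices H : ∀ f ∈ (reesIdeal F • (⊤ : Submodule (Rees F) (ReesModule FM))), ∀ k : ℤ,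
        (f k : M) ∈ FM (k - 1) by
      have := H _ h n
      rwa [DirectSum.of_eq_same] at this
    intro f hf
    refine Submodule.smul_induction_on hf ?_ ?_
    · intro c hc g _ k
      classical
      rw [← DirectSum.sum_support_of c, ← DirectSum.sum_support_of g, Finset.sum_smul_sum,
        DFinsupp.finsetSum_apply, AddSubgroup.val_finsetSum]
      refine AddSubgroup.sum_mem _ fun i _ => ?_
      rw [DFinsupp.finsetSum_apply, AddSubgroup.val_finsetSum]
      refine AddSubgroup.sum_mem _ fun l _ => ?_
      rw [DirectSum.Gmodule.of_smul_of]
      by_cases hk : i +ᵥ l = k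
      · subst hk
        rw [DirectSum.of_eq_same]
        have : i - 1 + l = i + l - 1 := by ring
        show (c i : R) • (g l : M) ∈ FM (i + l - 1)
        rw [← this]
        exact SetLike.GradedSMul.smul_mem (hc i) (g l).2
      · rw [DirectSum.of_eq_of_ne _ _ _ (Ne.symm hk)]
        exact zero_mem _
    · intro f g hf hg k
      exact (FM (k - 1)).add_mem (hf k) (hg k)
  · intro h
    -- The element `X` is `1` placed in degree `1`; it carries `x`, placed in degree `n - 1`, to `x`
    -- in degree `n`.
    have one_mem : (1 : R) ∈ F 1 :=
      IsFilteredRing.mono (by norm_num) (SetLike.GradedOne.one_mem (A := F))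
    have hX : DirectSum.of (fun n => F n) 1 ⟨1, one_mem⟩ ∈ reesIdeal F :=
      (of_mem_reesIdeal F _).2 (SetLike.GradedOne.one_mem (A := F))
    have := Submodule.smul_mem_smul hX (N := (⊤ : Submodule (Rees F) (ReesModule FM)))
      (n := DirectSum.of (fun n => FM n) (n - 1) ⟨x, h⟩) trivial
    rw [DirectSum.Gmodule.of_smul_of] at this
    convert this using 1
    refine DirectSum.of_eq_of_gradedMonoid_eq (A := fun n => FM n) ?_
    refine Sigma.subtype_ext ?_ ?_
    · exact (add_sub_cancel 1 n).symm
    · exact (one_smul R (x : M)).symm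

variable (F FM) in
set_option synthInstance.maxHeartbeats 100000 in
/-- No nonzero element of `G(R)` annihilates a nonzero element of `G(M)`. -/
def IsTorsionFreeGr : Prop :=
  ∀ (a : Gr F) (x : GrModule F FM), a • x = 0 → a = 0 ∨ x = 0

set_option synthInstance.maxHeartbeats 100000 in
/-- If `G(M)` is torsion free, then multiplication by an element of degree `d` raises degrees by
exactly `d`. -/
theorem mem_of_smul_mem
    (htf : IsTorsionFreeGr F FM)
    {r : R} {d : ℤ} (hr : r ∈ F d) (hr' : r ∉ F (d - 1)) {x : M} {n : ℤ}
    (hx : r • x ∈ FM (d + n)) : x ∈ FM n := by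
  by_contra hxn
  obtain ⟨k, hk⟩ := IsFilteredModule.exhaustive (F := F) (FM := FM) x
  -- `FM` may fail to be separated; it is `hxn` that bounds the degree `e` of `x` from below.
  obtain ⟨e, hne, he, he'⟩ := exists_degree (IsFilteredModule.mono (F := F)) hk hxn
  have hx' : r • x ∈ FM (d + e - 1) := IsFilteredModule.mono (F := F) (by omega) hx
  have key : Ideal.Quotient.mk (reesIdeal F) (DirectSum.of (fun n => F n) d ⟨r, hr⟩) •
      (Submodule.Quotient.mk (DirectSum.of (fun n => FM n) e ⟨x, he⟩) : GrModule F FM) = 0 := by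
    rw [Module.Quotient.mk_smul_mk, DirectSum.Gmodule.of_smul_of,
      Submodule.Quotient.mk_eq_zero]
    exact (of_mem_reesIdeal_smul_top F _).2 hx'
  rcases htf _ _ key with h | h
  · exact hr' ((of_mem_reesIdeal F _).1 (Ideal.Quotient.eq_zero_iff_mem.1 h))
  · exact he' ((of_mem_reesIdeal_smul_top F _).1 ((Submodule.Quotient.mk_eq_zero _).1 h))

end Degree

/-! ### Restriction maps -/

section Restriction

variable {R : Type u} [Ring R] {M : Type v} [AddCommGroup M] [Module R M]

namespace RTors

/-- The identities for restriction maps below all reduce to this one, by multiplying with a filter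
member that brings the elements into the image of `j`. -/
theorem Loc.res_j {κ τ : RTors R} (h : κ ≤ τ) (m : M) :
    Loc.res h M (Loc.j κ M m) = Loc.j τ M m :=
  Loc.mk_eq ⊤ τ.top_mem fun _ _ => ⟨trivial, trivial, rfl⟩

theorem Loc.res_self (κ : RTors R) (x : Loc κ M) : Loc.res le_rfl M x = x := by
  obtain ⟨I, hI, hx⟩ := Loc.exists_j x
  refine Loc.eq_of_smul_eq hI fun a ha => ?_
  obtain ⟨m, hm⟩ := hx a ha
  rw [← map_smul, hm, Loc.res_j]

theorem Loc.res_res {κ τ σ : RTors R} (h : κ ≤ τ) (h' : τ ≤ σ) (x : Loc κ M) :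
    Loc.res h' M (Loc.res h M x) = Loc.res (h.trans h') M x := by
  obtain ⟨I, hI, hx⟩ := Loc.exists_j x
  refine Loc.eq_of_smul_eq (h' (h hI)) fun a ha => ?_
  obtain ⟨m, hm⟩ := hx a ha
  rw [← map_smul, ← map_smul, ← map_smul, hm, Loc.res_j, Loc.res_j, Loc.res_j]

theorem Loc.res_act {κ τ : RTors R} (h : κ ≤ τ) (q : Loc κ R) (x : Loc κ M) :
    Loc.res h M (Loc.act q x) = Loc.act (Loc.res h R q) (Loc.res h M x) := by
  obtain ⟨I, hI, hq⟩ := Loc.exists_j q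
  refine Loc.eq_of_smul_eq (h hI) fun a ha => ?_
  obtain ⟨b, hb⟩ := hq a ha
  rw [← map_smul, Loc.smul_act hb, map_smul,
    Loc.smul_act (by rw [← map_smul, hb, Loc.res_j])]

theorem res_mem_locFilt {κ τ : RTors R} (h : κ ≤ τ) {F : ℤ → AddSubgroup R}
    {FM : ℤ → AddSubgroup M} {n : ℤ} {x : Loc κ M} (hx : x ∈ locFilt κ F FM n) :
    Loc.res h M x ∈ locFilt τ F FM n := by
  obtain ⟨I, hI, hx⟩ := hx
  refine ⟨I, h hI, fun k a ha haF => ?_⟩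
  obtain ⟨m, hm, e⟩ := hx k a ha haF
  exact ⟨m, hm, by rw [← map_smul, e, Loc.res_j]⟩

end RTors

end Restriction

/-! ### The quotient filtrations -/

section QuotientFiltration

namespace RTors

variable {R : Type u} [Ring R] {M : Type v} [AddCommGroup M] [Module R M]

theorem Loc.eq_zero_of_bot_mem {κ : RTors R} (h : ⊥ ∈ κ.filter) (x : Loc κ M) : x = 0 :=
  Loc.eq_zero h fun a ha => by rw [(Submodule.mem_bot R).1 ha, zero_smul]

theorem exists_ne_zero_of_mem {κ : RTors R} (h : ⊥ ∉ κ.filter) {I : Ideal R} (hI : I ∈ κ.filter) :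
    ∃ a ∈ I, a ≠ 0 :=
  Submodule.exists_mem_ne_zero_of_ne_bot fun e => h (e ▸ hI)

theorem j_injective [NoZeroDivisors R] {κ : RTors R} (h : ⊥ ∉ κ.filter) :
    Function.Injective (Loc.j κ R) := by
  refine (injective_iff_map_eq_zero _).2 fun r hr => ?_
  obtain ⟨I, hI, hIr⟩ := Loc.j_eq_zero_iff.1 hr
  obtain ⟨a, ha, ha0⟩ := exists_ne_zero_of_mem h hI
  exact (mul_eq_zero.1 (hIr a ha)).resolve_left ha0

variable {F : ℤ → AddSubgroup R} {FM : ℤ → AddSubgroup M}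

theorem locFilt_mono (hFM : Monotone FM) (κ : RTors R) : Monotone (locFilt κ F FM) := by
  rintro i k hik x ⟨I, hI, hx⟩
  refine ⟨I, hI, fun n a ha haF => ?_⟩
  obtain ⟨m, hm, e⟩ := hx n a ha haF
  exact ⟨m, hFM (by omega) hm, e⟩

/-- If `a q = j(b)` then `a (q x) = b x`, so the bound for `x` applies as soon as `b ∈ J`. The `a`
for which this is possible form a member of the filter. -/
theorem act_mem_locFilt [NoZeroDivisors R] {κ : RTors R} {i k : ℤ} {q : Loc κ R} {x : Loc κ M}
    (hq : q ∈ locFilt κ F F i) (hx : x ∈ locFilt κ F FM k) :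
    Loc.act q x ∈ locFilt κ F FM (i + k) := by
  by_cases hκ : ⊥ ∈ κ.filter
  · rw [Loc.eq_zero_of_bot_mem hκ (Loc.act q x)]
    exact zero_mem _
  obtain ⟨I, hI, hq⟩ := hq
  obtain ⟨J, hJ, hx⟩ := hx
  let K : Ideal R := Submodule.comap (LinearMap.toSpanSingleton R _ q) (Submodule.map (Loc.j κ R) J)
  have hK : K ∈ κ.filter := by
    obtain ⟨L, hL, hLq⟩ := Loc.exists_j q
    refine κ.mem_of_colon hL fun a ha => ?_
    obtain ⟨b, hb⟩ := hLq a ha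
    -- `(K : a)` contains `(J : b)`.
    refine κ.mem_of_le (κ.colon_mem hJ b) fun c hc => ⟨c * b, hc, ?_⟩
    rw [LinearMap.toSpanSingleton_apply, LinearMap.toSpanSingleton_apply, smul_eq_mul, mul_smul,
      hb, ← smul_eq_mul, map_smul]
  refine ⟨I ⊓ K, κ.inf_mem hI hK, fun n a ha haF => ?_⟩
  obtain ⟨b, hb, e⟩ := hq n a ha.1 haF
  obtain ⟨c, hc, e'⟩ := ha.2
  -- `b` has the right degree and `c` lies in `J`; injectivity of `j` makes them the same element.
  obtain rfl : c = b := j_injective hκ (e'.trans e)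
  rw [Loc.smul_act e, ← add_assoc]
  exact hx _ c hc hb

/-- Let `T γ` consist of the Rees elements whose components send `x` into `j(M)` with degree shift
at most `γ`. These left ideals ascend, hence stabilize at some `T N`. Each homogeneous element
coming from `I` lies in some `T γ`, so in `T N`, and `N` bounds the degree of `x`. -/
theorem exists_mem_locFilt [IsFilteredRing F] [IsFilteredModule F FM]
    (hN : IsNoetherianRing (Rees F)) {κ : RTors R} (x : Loc κ M) :
    ∃ n, x ∈ locFilt κ F FM n := by
  have hmono : Monotone FM := IsFilteredModule.mono (F := F)
  let T : ℕ →o Ideal (Rees F) :=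
    { toFun := fun γ =>
        { carrier := {f | ∀ k : ℤ, ∃ m ∈ FM (k + γ), (f k : R) • x = Loc.j κ M m}
          zero_mem' := fun k => ⟨0, zero_mem _, by simp⟩
          add_mem' := fun {f g} hf hg k => by
            obtain ⟨m, hm, e⟩ := hf k
            obtain ⟨m', hm', e'⟩ := hg k
            refine ⟨m + m', add_mem hm hm', ?_⟩
            rw [DirectSum.add_apply, AddSubgroup.coe_add, add_smul, e, e', map_add]
          smul_mem' := fun c f hf k => by
            classical
            choose m hm e using hf
            rw [smul_eq_mul, DirectSum.coe_mul_apply, Finset.sum_smul,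
              Finset.sum_congr rfl (g := fun ij => Loc.j κ M ((c ij.1 : R) • m ij.2))
                fun ij _ => by rw [mul_smul, e, map_smul], ← map_sum]
            refine ⟨_, AddSubgroup.sum_mem _ fun ij hij => ?_, rfl⟩
            have h : ij.1 + (ij.2 + (γ : ℤ)) = k + γ := by
              have := (Finset.mem_filter.1 hij).2
              omega
            rw [← h]
            exact SetLike.GradedSMul.smul_mem (c ij.1).2 (hm ij.2) }
      monotone' := fun γ δ h f hf k => by
        obtain ⟨m, hm, e⟩ := hf k
        exact ⟨m, hmono (by omega) hm, e⟩ }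
  obtain ⟨N, hN⟩ := monotone_stabilizes_iff_noetherian.2 hN T
  obtain ⟨I, hI, hx⟩ := Loc.exists_j x
  refine ⟨N, I, hI, fun n a ha haF => ?_⟩
  obtain ⟨m, hm⟩ := hx a ha
  obtain ⟨d, hd⟩ := IsFilteredModule.exhaustive (F := F) (FM := FM) m
  -- The index must be at least `N`, to be in the stable range, and at least `d - n`, so that `FM d
  -- ≤ FM (n + γ)`.
  have hmem : DirectSum.of (fun n => F n) n ⟨a, haF⟩ ∈ T (max N (d - n).toNat) := by
    intro k
    by_cases hk : n = k
    · subst hk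
      refine ⟨m, hmono ?_ hd, ?_⟩
      · push_cast
        have := Int.self_le_toNat (d - n)
        have := le_max_right (N : ℤ) ((d - n).toNat : ℤ)
        omega
      · rw [DirectSum.of_eq_same]
        exact hm
    · refine ⟨0, zero_mem _, ?_⟩
      rw [DirectSum.of_eq_of_ne _ _ _ (Ne.symm hk), AddSubgroup.coe_zero, zero_smul, map_zero]
  rw [← hN _ (le_max_left _ _)] at hmem
  have := hmem n
  rwa [DirectSum.of_eq_same] at this

/-- A section `x` over `κ` which restricts to a section of degree `≤ γ` over some nontrivial `τ ≥ κ`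
is itself of degree `≤ γ`, if `G(M)` is torsion free. -/
theorem mem_locFilt_of_res_mem [IsFilteredRing F] [IsFilteredModule F FM] [IsDomain (Gr F)]
    (htf : IsTorsionFreeGr F FM)
    {κ τ : RTors R} (h : κ ≤ τ) (hτ : ⊥ ∉ τ.filter) {γ : ℤ} {x : Loc κ M}
    (hx : Loc.res h M x ∈ locFilt τ F FM γ) : x ∈ locFilt κ F FM γ := by
  have hmono : Monotone FM := IsFilteredModule.mono (F := F)
  obtain ⟨J, hJ, hx⟩ := hx
  obtain ⟨I, hI, hIx⟩ := Loc.exists_j x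
  refine ⟨I, hI, fun n a ha haF => ?_⟩
  by_cases ha0 : a = 0
  · exact ⟨0, zero_mem _, by rw [ha0, zero_smul, map_zero]⟩
  obtain ⟨m, hm⟩ := hIx a ha
  refine ⟨m, ?_, hm⟩
  -- The ideal `J`, on which the degree bound is known, belongs to `τ.filter` only. A nonzero `c`
  -- with `c * a ∈ J` carries the bound over to `c • m`, and `c` is divided out at the end.
  obtain ⟨c, hc, hc0⟩ := exists_ne_zero_of_mem hτ (τ.colon_mem hJ a)
  obtain ⟨e, he, he'⟩ := exists_ring_degree (F := F) hc0
  obtain ⟨m', hm', e'⟩ := hx (e + n) (c * a) hc (SetLike.mul_mem_graded he haF)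
  have htors : c • m - m' ∈ τ.torsion M := by
    rw [← Loc.j_eq_zero_iff, map_sub, map_smul, ← e', mul_smul, ← map_smul _ a, hm, Loc.res_j,
      sub_self]
  obtain ⟨K, hK, hKm⟩ := htors
  obtain ⟨b, hb, hb0⟩ := exists_ne_zero_of_mem hτ hK
  obtain ⟨d, hd, hd'⟩ := exists_ring_degree (F := F) hb0
  -- `c • m` and `m'` agree only up to `τ`-torsion, but a nonzero `b` kills the difference. As `0`
  -- lies in every step of `FM`, dividing by `b` puts the difference in every step too.
  have hdiff : c • m - m' ∈ FM (e + n + γ) :=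
    mem_of_smul_mem htf hd hd' ((hKm b hb).symm ▸ zero_mem _)
  refine mem_of_smul_mem htf he he' ?_
  have := add_mem hdiff hm'
  rwa [sub_add_cancel, add_assoc] at this

/-- If `a q = j(b)` with `b ≠ 0`, a multiple `c * b` with `c ≠ 0` has degree exactly the sum of the
two degrees, while arbitrarily low degree of `q` forces it lower. -/
theorem eq_zero_of_forall_mem_locFilt [IsFilteredRing F] [IsDomain (Gr F)] {κ : RTors R}
    {q : Loc κ R} (hq : ∀ n, q ∈ locFilt κ F F n) : q = 0 := by
  by_cases hκ : ⊥ ∈ κ.filter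
  · exact Loc.eq_zero_of_bot_mem hκ q
  have := noZeroDivisors_of_isDomain_gr F
  obtain ⟨I, hI, hIq⟩ := Loc.exists_j q
  refine Loc.eq_zero hI fun a ha => ?_
  obtain ⟨b, hb⟩ := hIq a ha
  by_contra hne
  have hb0 : b ≠ 0 := fun h => hne (by rw [hb, h, map_zero])
  obtain ⟨n, hn⟩ := IsFilteredRing.exhaustive (F := F) a
  obtain ⟨d, hd, hd'⟩ := exists_ring_degree (F := F) hb0
  -- With this index, `c * b` is forced into degree `e + n + (d - 1 - n)`, one less than `e + d`.
  obtain ⟨J, hJ, hJq⟩ := hq (d - 1 - n)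
  obtain ⟨c, hc, hc0⟩ := exists_ne_zero_of_mem hκ (κ.colon_mem hJ a)
  obtain ⟨e, he, he'⟩ := exists_ring_degree (F := F) hc0
  obtain ⟨m, hm, hm'⟩ := hJq (e + n) (c * a) hc (SetLike.mul_mem_graded he hn)
  have hcb : c * b = m := j_injective hκ <| by
    rw [← hm', mul_smul, hb, ← smul_eq_mul, map_smul]
  refine mul_notMem he he' hd hd' ?_
  rw [hcb]
  convert hm using 2
  ring

end RTors

/-! ### Assembling the filtered presheaves and the sheaf of gliders -/

variable {R : Type u} [Ring R] {F : ℤ → AddSubgroup R} [IsFilteredRing F]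
variable {Ω : Type v} [AddCommGroup Ω] [Module R Ω]
variable {FΩ : ℤ → AddSubgroup Ω} [IsFilteredModule F FΩ]

/-- Lets the results on filtered modules apply to `N = R`. -/
instance : IsFilteredModule F F where
  smul_mem := fun {_ _ _ _} ha hb => SetLike.mul_mem_graded ha hb
  mono := IsFilteredRing.mono
  exhaustive := IsFilteredRing.exhaustive

theorem isPresheafOfFilteredRings [IsDomain (Gr F)] (hN : IsNoetherianRing (Rees F)) :
    IsPresheafOfFilteredRings F where
  filtered κ :=
    { one_mem := ⟨⊤, κ.top_mem, fun n a _ haF => ⟨a, by rwa [add_zero], by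
        rw [show (1 : Loc κ R) = Loc.j κ R 1 from rfl, ← map_smul, smul_eq_mul, mul_one]⟩⟩
      mul_mem := fun {_ _ _ _} hp hq =>
        have := noZeroDivisors_of_isDomain_gr F
        act_mem_locFilt hp hq
      mono := locFilt_mono IsFilteredRing.mono κ
      exhaustive := exists_mem_locFilt hN
      separated := fun _ => eq_zero_of_forall_mem_locFilt }
  res_self := Loc.res_self
  res_res := Loc.res_res
  res_one h := Loc.res_j h 1
  res_mul := Loc.res_act
  res_mem h _ _ := res_mem_locFilt h

theorem isPresheafOfFilteredModules [IsDomain (Gr F)] (hN : IsNoetherianRing (Rees F)) :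
    IsPresheafOfFilteredModules F FΩ where
  filtered κ :=
    { smul_mem := fun {_ _ _ _} hp hq =>
        have := noZeroDivisors_of_isDomain_gr F
        act_mem_locFilt hp hq
      mono := locFilt_mono (IsFilteredModule.mono (F := F)) κ
      exhaustive := exists_mem_locFilt hN }
  res_self := Loc.res_self
  res_res := Loc.res_res
  res_smul := Loc.res_act
  res_mem h _ _ := res_mem_locFilt h

theorem filteredSheafAxioms_of_torsionFree [IsDomain (Gr F)]
    (htf : IsTorsionFreeGr F FΩ)
    (h : IsSheafOfModules R Ω) : FilteredSheafAxioms F FΩ where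
  toIsSheafOfModules := h
  glue_mem := by
    intro κ m κs hκ x _ n hx y hy
    -- If all `Q_{κᵢ}(Ω)` vanish, which includes the empty cover, separation gives `y = 0`.
    -- Otherwise a single nontrivial `κᵢ` decides the degree of `y`.
    by_cases hall : ∀ i, ⊥ ∈ (κs i).filter
    · have hy0 : y = 0 := h.sep hκ y fun i => Loc.eq_zero_of_bot_mem (hall i) _
      rw [hy0]
      exact zero_mem _
    · obtain ⟨i, hi⟩ := not_forall.1 hall
      exact mem_locFilt_of_res_mem htf (hκ.le i) hi ((hy i).symm ▸ hx i)

theorem isSheafOfGliders [IsDomain (Gr F)] (hN : IsNoetherianRing (Rees F))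
    (h : FilteredSheafAxioms F FΩ) : IsSheafOfGliders F FΩ where
  rings := isPresheafOfFilteredRings hN
  modules := isPresheafOfFilteredModules hN
  glider κ :=
    { anti := fun i k hik => locFilt_mono (IsFilteredModule.mono (F := F)) κ (by omega)
      smul_mem := fun i k hik a ha x hx => by
        have := noZeroDivisors_of_isDomain_gr F
        have hax := act_mem_locFilt ha hx
        -- `hik` ensures that the subtraction in `ℕ` is not truncated.
        rwa [show (i : ℤ) + -(k : ℤ) = -((k - i : ℕ) : ℤ) by omega] at hax }
  sep hκ x _ := h.sep hκ x
  glue hκ x hx hc := by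
    obtain ⟨y, hy⟩ := h.glue hκ x hc
    exact ⟨y, h.glue_mem hκ x hc 0 hx y hy, hy, fun n hn => h.glue_mem hκ x hc _ hn y hy⟩

end QuotientFiltration

end GliderSheaf

theorem mainTheorem4 {R : Type*} [Ring R] (F : ℤ → AddSubgroup R) [GliderSheaf.IsFilteredRing F]
    (hZ : GliderSheaf.IsZariskian F) (hac : GliderSheaf.IsAlmostCommutative F)
    {Ω : Type*} [AddCommGroup Ω] [Module R Ω]
    (M : ℕ → AddSubgroup Ω) (hM : GliderSheaf.IsGlider F M)
    (FΩ : ℤ → AddSubgroup Ω) [GliderSheaf.IsFilteredModule F FΩ]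
    (hMΩ : ∀ n : ℕ, FΩ (-(n : ℤ)) = M n) :
    (FaithfulSMul (GliderSheaf.Gr F) (GliderSheaf.GrModule F FΩ) →
      GliderSheaf.FilteredSheafAxioms F FΩ → GliderSheaf.IsSheafOfGliders F FΩ) ∧
    ((∀ (a : GliderSheaf.Gr F) (x : GliderSheaf.GrModule F FΩ), a • x = 0 → a = 0 ∨ x = 0) →
      GliderSheaf.IsSheafOfModules R Ω → GliderSheaf.IsSheafOfGliders F FΩ) := by
  have := hac.isDomain
  exact ⟨fun _ h => GliderSheaf.isSheafOfGliders hZ.noetherian h,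
    fun htf h => GliderSheaf.isSheafOfGliders hZ.noetherian
      (GliderSheaf.filteredSheafAxioms_of_torsionFree htf h)⟩
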